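/- Consider $K$ transmitter/receiver (TX/RX) pairs, pair $i$ being located at a point $p_i\in\mathbb{R}^2$, where the points $p_1,\dots,p_K$ are distinct, and let $\mathrm{dist}(i,k)=\|p_i-p_k\|$ be the Euclidean distance. Let $\gamma<1$ be fixed, and for each SNR $P>1$ let $\mu^2=P^{\gamma-1}$, i.e. $\gamma=\log(\mu^2P)/\log P$. At SNR $P$ the channel from TX $i$ to RX $k$ is $H_{ki}=\sigma_{ki}\tilde H_{ki}$, with exponential pathloss $\sigma_{ki}^2=(\mu^2)^{\mathrm{dist}(i,k)}=P^{\Gamma_{ki}-1}$, where $\Gamma_{ki}=1+(\gamma-1)\,\mathrm{dist}(k,i)$, and with each $\tilde H_{ki}$ circularly symmetric complex Gaussian $\mathcal N(0,1)$. A CSIT allocation $\{\mathbf B^{(j)}\}_{j=1}^K$ gives, at each SNR $P$, a number $B^{(j)}_{ki}\ge 0$ of bits to TX $j$ for the coefficient $(k,i)$. TX $j$ then has the channel estimate $\mathbf H^{(j)}$ with $$H^{(j)}_{ki}=\sigma_{ki}\tilde H_{ki}+\sigma_{ki}\sqrt{2^{-B^{(j)}_{ki}}}\,\Delta\tilde H^{(j)}_{ki},$$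 where the errors $\Delta\tilde H^{(j)}_{ki}\sim\mathcal N(0,1)$ (circularly symmetric complex Gaussian) are mutually independent and independent of the channel. Each TX $j$ computes the zero-forcing precoder $\mathbf T^{(j)}$ of its own estimate, with columns $$\boldsymbol t^{(j)}_i=\sqrt P\,\frac{(\mathbf H^{(j)})^{-1}\boldsymbol e_i}{\|(\mathbf H^{(j)})^{-1}\boldsymbol e_i\|},$$ and the effective precoder $\mathbf T=[\boldsymbol t_1,\dots,\boldsymbol t_K]$ has as its $j$-th row the $j$-th row of $\mathbf T^{(j)}$. With $\boldsymbol h_i^{\mathrm H}$ the $i$-th row of $\mathbf H$, the ergodic rate and the generalized DoF of user $i$ are $$R_i=\mathbb E\left[\log_2\left(1+\frac{|\boldsymbol h_i^{\mathrm H}\boldsymbol t_i|^2}{1+\sum_{\ell\ne i}|\boldsymbol h_i^{\mathrm H}\boldsymbol t_\ell|^2}\right)\right],\qquad \mathrm{DoF}_i=\lim_{P\to\infty}\frac{R_i}{\log_2P},$$ the limit being taken with $\boldsymbol\Gamma$ fixed and $\sigma_{ki}^2=P^{\Gamma_{ki}-1}$. Let $\mathbb B_{\mathrm{DoF}}(\boldsymbol\Gamma)$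 be the set of the CSIT allocations with $\mathrm{DoF}_i=1$ for every $i$. Then the distance-based CSIT allocation $$\{\mathbf B^{\mathrm{Dist},(j)}\}_{ki}=\left\lceil\left[1+(\gamma-1)\left(\mathrm{dist}(j,k)+\mathrm{dist}(k,i)\right)\right]^+\log_2P\right\rceil,\qquad \forall k,i,j,$$ belongs to $\mathbb B_{\mathrm{DoF}}(\boldsymbol\Gamma)$: under distributed zero-forcing precoding, it achieves the maximal generalized DoF of $1$ at every user. -/

import Mathlib

open MeasureTheory ProbabilityTheory Filter Topology
open scoped NNReal

noncomputable section

namespace SpatialCSIT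

/-- The circularly symmetric complex Gaussian law of mean zero and variance one: independent real
and imaginary parts, each a centred real Gaussian of variance `1 / 2`. -/
def complexGaussian : Measure ℂ :=
  ((gaussianReal 0 (1 / 2)).prod (gaussianReal 0 (1 / 2))).map
    (fun p : ℝ × ℝ => (p.1 : ℂ) + (p.2 : ℂ) * Complex.I)

/-- The randomness of the model. `Ht k i` is the normalized fading coefficient from TX `i` to
RX `k`, and `Dt j k i` the normalized error of TX `j` on this coefficient. All of them are standard
complex Gaussian, the errors are mutually independent, and they are independent of the channel.
(Nothing is required of the joint law of the entries of the channel.) -/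
structure IsRayleighModel {K : ℕ} {Ω : Type*} [MeasurableSpace Ω] (Pr : Measure Ω)
    (Ht : Fin K → Fin K → Ω → ℂ) (Dt : Fin K → Fin K → Fin K → Ω → ℂ) : Prop where
  measurable_channel : ∀ k i, Measurable (Ht k i)
  measurable_error : ∀ j k i, Measurable (Dt j k i)
  law_channel : ∀ k i, Pr.map (Ht k i) = complexGaussian
  law_error : ∀ j k i, Pr.map (Dt j k i) = complexGaussian
  indep_error : iIndepFun (fun a : Fin K × Fin K × Fin K => Dt a.1 a.2.1 a.2.2) Pr
  indep_error_channel :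
    IndepFun (fun ω (a : Fin K × Fin K × Fin K) => Dt a.1 a.2.1 a.2.2 ω)
      (fun ω (b : Fin K × Fin K) => Ht b.1 b.2 ω) Pr

/-- A CSIT allocation: at SNR `P`, TX `j` is given `B P j k i` bits for the channel coefficient
from TX `i` to RX `k`. -/
abbrev CSITAllocation (K : ℕ) : Type := ℝ → Fin K → Matrix (Fin K) (Fin K) ℝ≥0

variable {K : ℕ}

/-- The amplitude `σ` of each link at SNR `P` for the interference level matrix `Γ`, that is
`σ² = P ^ (Γ - 1)`. -/
def amplitude (Γ : Matrix (Fin K) (Fin K) ℝ) (P : ℝ) (k i : Fin K) : ℝ :=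
  Real.sqrt (P ^ (Γ k i - 1))

/-- The multi-user channel matrix for a realization `ht` of the normalized fading. -/
def channel (Γ : Matrix (Fin K) (Fin K) ℝ) (P : ℝ) (ht : Fin K → Fin K → ℂ) :
    Matrix (Fin K) (Fin K) ℂ :=
  Matrix.of fun k i => (amplitude Γ P k i : ℂ) * ht k i

/-- The estimate of the channel at a TX with bit matrix `b` and normalized error `dt`. -/
def channelEstimate (Γ : Matrix (Fin K) (Fin K) ℝ) (P : ℝ) (b : Matrix (Fin K) (Fin K) ℝ≥0)
    (ht dt : Fin K → Fin K → ℂ) : Matrix (Fin K) (Fin K) ℂ :=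
  Matrix.of fun k i => (amplitude Γ P k i : ℂ) * ht k i +
    ((amplitude Γ P k i * Real.sqrt ((2 : ℝ) ^ (-(b k i : ℝ))) : ℝ) : ℂ) * dt k i

/-- The zero-forcing precoder computed from the matrix `A` at power `P`: column `i` is
`√P • A⁻¹ eᵢ / ‖A⁻¹ eᵢ‖`, with the Euclidean norm. -/
def zfPrecoder (P : ℝ) (A : Matrix (Fin K) (Fin K) ℂ) : Matrix (Fin K) (Fin K) ℂ :=
  Matrix.of fun m i =>
    (Real.sqrt P : ℂ) * (A⁻¹ m i / ((‖WithLp.toLp 2 (fun l => A⁻¹ l i)‖ : ℝ) : ℂ))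

/-- The effective precoder of the distributed scheme: row `j` is the row `j` of the zero-forcing
precoder that TX `j` computes from its own estimate. -/
def distributedPrecoder (Γ : Matrix (Fin K) (Fin K) ℝ) (P : ℝ)
    (b : Fin K → Matrix (Fin K) (Fin K) ℝ≥0) (ht : Fin K → Fin K → ℂ)
    (dt : Fin K → Fin K → Fin K → ℂ) : Matrix (Fin K) (Fin K) ℂ :=
  Matrix.of fun j i => zfPrecoder P (channelEstimate Γ P (b j) ht (dt j)) j i

/-- The signal-to-interference-and-noise ratio at RX `i` for the channel `H` and the precoder `T`,
with noise of variance one. The entry `(i, l)` of `H * T` is the gain at RX `i` of stream `l`. -/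
def sinr (H T : Matrix (Fin K) (Fin K) ℂ) (i : Fin K) : ℝ :=
  ‖(H * T) i i‖ ^ 2 / (1 + ∑ l ∈ Finset.univ.erase i, ‖(H * T) i l‖ ^ 2)

/-- The ergodic rate of user `i` at SNR `P`. -/
def ergodicRate {Ω : Type*} [MeasurableSpace Ω] (Pr : Measure Ω)
    (Ht : Fin K → Fin K → Ω → ℂ) (Dt : Fin K → Fin K → Fin K → Ω → ℂ)
    (Γ : Matrix (Fin K) (Fin K) ℝ) (B : CSITAllocation K) (P : ℝ) (i : Fin K) : ℝ :=
  ∫ ω, Real.logb 2 (1 + sinr (channel Γ P (fun k l => Ht k l ω))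
    (distributedPrecoder Γ P (B P) (fun k l => Ht k l ω) (fun j k l => Dt j k l ω)) i) ∂Pr

/-- The generalized DoF at RX `i` exists and is equal to `d`: it is the limit of the ratio of the
ergodic rate to `log₂ P` while the pathloss scales with the SNR according to `Γ`. -/
def HasGeneralizedDoF {Ω : Type*} [MeasurableSpace Ω] (Pr : Measure Ω)
    (Ht : Fin K → Fin K → Ω → ℂ) (Dt : Fin K → Fin K → Fin K → Ω → ℂ)
    (Γ : Matrix (Fin K) (Fin K) ℝ) (B : CSITAllocation K) (i : Fin K) (d : ℝ) : Prop :=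
  Tendsto (fun P : ℝ => ergodicRate Pr Ht Dt Γ B P i / Real.logb 2 P) atTop (𝓝 d)

/-- The set of the DoF-achieving CSIT allocations. -/
def dofAchieving {Ω : Type*} [MeasurableSpace Ω] (Pr : Measure Ω)
    (Ht : Fin K → Fin K → Ω → ℂ) (Dt : Fin K → Fin K → Fin K → Ω → ℂ)
    (Γ : Matrix (Fin K) (Fin K) ℝ) : Set (CSITAllocation K) :=
  {B | ∀ i, HasGeneralizedDoF Pr Ht Dt Γ B i 1}

/-- The attenuation per unit of distance at SNR `P`: the number `μ²` for which
`γ = log (μ² P) / log P`. -/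
def muSq (γ P : ℝ) : ℝ := P ^ (γ - 1)

/-- The interference level matrix of the network with pair `i` located at `pos i` and exponential
pathloss `(μ²) ^ dist`. -/
def interferenceLevel (γ : ℝ) (pos : Fin K → EuclideanSpace ℝ (Fin 2)) :
    Matrix (Fin K) (Fin K) ℝ :=
  Matrix.of fun k i => 1 + (γ - 1) * dist (pos k) (pos i)

/-- `muSq` is the attenuation that belongs to `γ`, and it is the only one. -/
theorem eq_muSq_iff (γ P m : ℝ) (hP : 1 < P) (hm : 0 < m) :
    γ = Real.log (m * P) / Real.log P ↔ m = muSq γ P := by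
  have hP0 : 0 < P := by linarith
  have hl : 0 < Real.log P := Real.log_pos hP
  rw [muSq, eq_div_iff hl.ne', Real.log_mul hm.ne' hP0.ne']
  constructor
  · intro h
    rw [Real.rpow_def_of_pos hP0, show Real.log P * (γ - 1) = Real.log m by linarith, Real.exp_log hm]
  · intro h
    rw [h, Real.log_rpow hP0]
    ring

/-- For the interference level matrix of the network, the pathloss of the link from TX `i` to
RX `k` is `(μ²) ^ dist`. -/
theorem amplitude_sq_interferenceLevel (γ P : ℝ) (hP : 1 < P)
    (pos : Fin K → EuclideanSpace ℝ (Fin 2)) (k i : Fin K) :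
    amplitude (interferenceLevel γ pos) P k i ^ 2 = muSq γ P ^ dist (pos i) (pos k) := by
  have hP0 : 0 ≤ P := by linarith
  rw [amplitude, Real.sq_sqrt (Real.rpow_nonneg hP0 _), muSq, ← Real.rpow_mul hP0,
    interferenceLevel, Matrix.of_apply, dist_comm (pos i)]
  congr 1
  ring

/-- The distance-based CSIT allocation. (For `1 ≤ P` the argument of the ceiling is nonnegative,
so that the ceiling in the natural numbers is the usual one.) -/
def distanceAllocation (γ : ℝ) (pos : Fin K → EuclideanSpace ℝ (Fin 2)) : CSITAllocation K :=
  fun P j => Matrix.of fun k i =>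
    (⌈max (1 + (γ - 1) * (dist (pos j) (pos k) + dist (pos k) (pos i))) 0 *
      Real.logb 2 P⌉₊ : ℝ≥0)

end SpatialCSIT

end

/-!
For fixed fading, the SINR of every user is bounded above and, for large `P`, below by positive
multiples of `P`. Hence the normalized rate converges to one pointwise almost surely, and dominated
convergence carries this to the expectation: by `sinr_distributedPrecoder_le` the integrand is,
for `P ≥ 2`, at most `1 + X / log 2`, where `X` is a multiple of the sum of the squared channel moduli.

The lower bound is deterministic. Let `ρ` be the distance scaled so that the link `(k, i)` has
amplitude `P ^ (-ρ k i)`. Since the positions are distinct, the channel tends to its diagonal, so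
that nothing is needed from the fading except that the diagonal coefficients, and their estimates
by a TX without bits, are nonzero; this holds almost surely. By the triangle inequality the decay
`O(P ^ (-ρ k i))` is inherited by the inverse (`IsLocalized.isBigO_inv`). With the distance-based
allocation, the error of TX `j` on the coefficient `(k, i)` is `O(P ^ (-1/2 + ρ j k))`
(`isBigO_channel_sub_channelEstimate`): TX `j` needs less precision on the rows of remote receivers.
The resolvent identity `B⁻¹ - A⁻¹ = B⁻¹ (A - B) A⁻¹` then shows that row `j` of the inverse, the only
one that TX `j` uses, is off by `O(P ^ (-1/2))` (`IsLocalized.isBigO_inv_sub_inv`). The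
normalization of the columns does not spoil this: the norm of column `l` may be off by
`O(P ^ (-1/2 + ρ j l))`, but it is applied to an entry of size `O(P ^ (-ρ j l))`
(`IsLocalized.isBigO_normalized_inv_sub`). After multiplication by `√P` the gains differ from those
of exact zero-forcing by `O(1)` (`isBigO_gain_sub`), so that the interference is bounded while the
signal amplitude grows like `√P`.
-/

open MeasureTheory ProbabilityTheory Filter Topology Asymptotics
open scoped NNReal

noncomputable section

namespace SpatialCSIT

variable {ι : Type*} [Fintype ι] [DecidableEq ι]

/-! ### Powers of the SNR -/

theorem isBigO_rpow_mul {f g : ℝ → ℂ} {s t u : ℝ}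
    (hf : f =O[atTop] fun P : ℝ => P ^ s) (hg : g =O[atTop] fun P : ℝ => P ^ t)
    (hu : s + t = u) : (fun P => f P * g P) =O[atTop] fun P : ℝ => P ^ u := by
  refine (hf.mul hg).congr' EventuallyEq.rfl ?_
  filter_upwards [eventually_gt_atTop 0] with P hP
  rw [← Real.rpow_add hP, hu]

theorem isBigO_rpow_mono {f : ℝ → ℂ} {s t : ℝ} (hf : f =O[atTop] fun P : ℝ => P ^ s)
    (hst : s ≤ t) : f =O[atTop] fun P : ℝ => P ^ t := by
  refine hf.trans (IsBigO.of_bound 1 ?_)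
  filter_upwards [eventually_ge_atTop 1] with P hP
  have hP0 : 0 ≤ P := by linarith
  rw [one_mul, Real.norm_of_nonneg (Real.rpow_nonneg hP0 _),
    Real.norm_of_nonneg (Real.rpow_nonneg hP0 _)]
  exact Real.rpow_le_rpow_of_exponent_le hP hst

theorem isBigO_rpow_of_tendsto {f : ℝ → ℂ} {c : ℂ} (hf : Tendsto f atTop (𝓝 c)) :
    f =O[atTop] fun P : ℝ => P ^ (0 : ℝ) := by
  simpa only [Real.rpow_zero] using hf.isBigO_one ℝ

theorem isBigO_rpow_sum {α : Type*} {s : Finset α} {f : α → ℝ → ℂ} {t : ℝ}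
    (hf : ∀ i ∈ s, f i =O[atTop] fun P : ℝ => P ^ t) :
    (fun P => ∑ i ∈ s, f i P) =O[atTop] fun P : ℝ => P ^ t := by
  have h := IsBigO.sum hf
  rwa [Finset.sum_fn] at h

/-! ### Inverses of matrices whose entries decay with the distance -/

/-- The axioms of a distance, for a function `ρ` on pairs of indices. -/
structure IsDistance (ρ : ι → ι → ℝ) : Prop where
  self : ∀ i, ρ i i = 0
  symm : ∀ i k, ρ i k = ρ k i
  triangle : ∀ i k l, ρ i l ≤ ρ i k + ρ k l
  pos : ∀ i k, i ≠ k → 0 < ρ i k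

/-- A family of matrices, indexed by the SNR `P`, is localized for the distance `ρ` with limiting
diagonal `x` if its entry `(k, i)` is `O(P ^ (-ρ k i))`, and its diagonal converges to `x`, which
has no zero entry. -/
structure IsLocalized (ρ : ι → ι → ℝ) (A : ℝ → Matrix ι ι ℂ) (x : ι → ℂ) : Prop where
  decay : ∀ k i, (fun P => A P k i) =O[atTop] fun P : ℝ => P ^ (-ρ k i)
  tendsto_diag : ∀ k, Tendsto (fun P => A P k k) atTop (𝓝 (x k))
  ne_zero : ∀ k, x k ≠ 0

/-- In each term of the Leibniz expansion of the `(m, l)` entry of the adjugate, the telescoping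
sum of the distances to `l` along the permutation is `ρ m l`, and the triangle inequality compares
it with the decay of the factors. -/
theorem isBigO_adjugate {ρ : ι → ι → ℝ} (hρ : IsDistance ρ) {A : ℝ → Matrix ι ι ℂ}
    (hA : ∀ k i, (fun P => A P k i) =O[atTop] fun P : ℝ => P ^ (-ρ k i)) (m l : ι) :
    (fun P => (A P).adjugate m l) =O[atTop] fun P : ℝ => P ^ (-ρ m l) := by
  simp only [Matrix.adjugate_apply, Matrix.det_apply]
  refine isBigO_rpow_sum fun τ _ => ?_
  have hentry : ∀ k i, (fun P => (A P).updateRow l (Pi.single m 1) k i) =O[atTop]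
      fun P : ℝ => P ^ (ρ i l - ρ k l - if k = l then ρ m l else 0) := by
    intro k i
    by_cases hk : k = l
    · subst hk
      simp only [Matrix.updateRow_self, if_true]
      by_cases hi : i = m
      · subst hi
        simpa [hρ.self] using isBigO_refl (fun _ : ℝ => (1 : ℂ)) atTop |>.trans
          (isBigO_const_const (1 : ℂ) (one_ne_zero (α := ℝ)) atTop)
      · simpa [Pi.single_eq_of_ne hi] using isBigO_zero _ _
    · simp only [Matrix.updateRow_ne hk, if_neg hk]
      exact isBigO_rpow_mono (hA k i) (by have := hρ.triangle k i l; linarith)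
  have hprod := IsBigO.finsetProd (s := Finset.univ) fun i _ => hentry (τ i) i
  have hsum : ∑ i, (ρ i l - ρ (τ i) l - if τ i = l then ρ m l else 0) = -ρ m l := by
    rw [Finset.sum_sub_distrib, Finset.sum_sub_distrib,
      Equiv.sum_comp τ (fun k => ρ k l), Equiv.sum_comp τ (fun k => if k = l then ρ m l else 0)]
    simp
  have hterm : (fun P => ∏ i, (A P).updateRow l (Pi.single m 1) (τ i) i) =O[atTop]
      fun P : ℝ => P ^ (-ρ m l) := by
    refine hprod.congr' EventuallyEq.rfl ?_
    filter_upwards [eventually_gt_atTop 0] with P hP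
    rw [← Real.rpow_sum_of_pos hP, hsum]
  simp only [Units.smul_def, zsmul_eq_mul]
  exact hterm.const_mul_left _

namespace IsLocalized

variable {ρ : ι → ι → ℝ} {A B : ℝ → Matrix ι ι ℂ} {x y : ι → ℂ}

omit [Fintype ι] in
theorem tendsto (hρ : IsDistance ρ) (hA : IsLocalized ρ A x) :
    Tendsto A atTop (𝓝 (Matrix.diagonal x)) := by
  refine tendsto_pi_nhds.2 fun k => tendsto_pi_nhds.2 fun i => ?_
  by_cases h : k = i
  · subst h
    simpa using hA.tendsto_diag k
  · rw [Matrix.diagonal_apply_ne _ h]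
    exact (hA.decay k i).trans_tendsto (tendsto_rpow_neg_atTop (hρ.pos k i h))

theorem tendsto_det (hρ : IsDistance ρ) (hA : IsLocalized ρ A x) :
    Tendsto (fun P => (A P).det) atTop (𝓝 (∏ k, x k)) := by
  rw [← Matrix.det_diagonal]
  exact ((continuous_id.matrix_det).tendsto (Matrix.diagonal x)).comp (hA.tendsto hρ)

omit [DecidableEq ι] in
theorem prod_ne_zero (hA : IsLocalized ρ A x) : ∏ k, x k ≠ 0 :=
  Finset.prod_ne_zero_iff.2 fun k _ => hA.ne_zero k

theorem eventually_isUnit (hρ : IsDistance ρ) (hA : IsLocalized ρ A x) :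
    ∀ᶠ P in atTop, IsUnit (A P) := by
  filter_upwards [(hA.tendsto_det hρ).eventually_ne hA.prod_ne_zero] with P hP
  exact (Matrix.isUnit_iff_isUnit_det _).2 (isUnit_iff_ne_zero.2 hP)

theorem tendsto_inv (hρ : IsDistance ρ) (hA : IsLocalized ρ A x) :
    Tendsto (fun P => (A P)⁻¹) atTop (𝓝 (Matrix.diagonal x)⁻¹) := by
  simp only [Matrix.inv_def, Ring.inverse_eq_inv', Matrix.det_diagonal]
  exact ((hA.tendsto_det hρ).inv₀ hA.prod_ne_zero).smul
    (((continuous_id.matrix_adjugate).tendsto (Matrix.diagonal x)).comp (hA.tendsto hρ))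

/-- The inverse of a localized family decays with the distance at the same rate. -/
theorem isBigO_inv (hρ : IsDistance ρ) (hA : IsLocalized ρ A x) (m l : ι) :
    (fun P => (A P)⁻¹ m l) =O[atTop] fun P : ℝ => P ^ (-ρ m l) := by
  simp only [Matrix.inv_def, Ring.inverse_eq_inv', Matrix.smul_apply, smul_eq_mul]
  exact isBigO_rpow_mul
    (isBigO_rpow_of_tendsto ((hA.tendsto_det hρ).inv₀ hA.prod_ne_zero))
    (isBigO_adjugate hρ hA.decay m l) (zero_add _)

end IsLocalized

/-- The Euclidean norm of the column `l` of the inverse of `A`. -/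
def invColNorm (A : Matrix ι ι ℂ) (l : ι) : ℝ := ‖WithLp.toLp 2 (fun m => A⁻¹ m l)‖

theorem invColNorm_sq (A : Matrix ι ι ℂ) (l : ι) :
    invColNorm A l ^ 2 = ∑ m, ‖A⁻¹ m l‖ ^ 2 := by
  rw [invColNorm, EuclideanSpace.norm_sq_eq]

theorem norm_inv_apply_le_invColNorm (A : Matrix ι ι ℂ) (m l : ι) :
    ‖A⁻¹ m l‖ ≤ invColNorm A l :=
  PiLp.norm_apply_le (WithLp.toLp 2 (fun m => A⁻¹ m l)) m

namespace IsLocalized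

variable {ρ : ι → ι → ℝ} {A B : ℝ → Matrix ι ι ℂ} {x y : ι → ℂ}

theorem tendsto_invColNorm (hρ : IsDistance ρ) (hA : IsLocalized ρ A x) (l : ι) :
    Tendsto (fun P => invColNorm (A P) l) atTop (𝓝 (invColNorm (Matrix.diagonal x) l)) := by
  have hc : Continuous fun M : Matrix ι ι ℂ => ‖WithLp.toLp 2 (fun m => M m l)‖ := by
    refine (PiLp.continuous_toLp 2 _).norm.comp ?_
    exact continuous_pi fun m => continuous_id.matrix_elem m l
  exact (hc.tendsto _).comp (hA.tendsto_inv hρ)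

theorem invColNorm_diagonal_pos (hA : IsLocalized ρ A x) (l : ι) :
    0 < invColNorm (Matrix.diagonal x) l := by
  refine lt_of_lt_of_le ?_ (norm_inv_apply_le_invColNorm _ l l)
  have hx : IsUnit x := Pi.isUnit_iff.2 fun k => isUnit_iff_ne_zero.2 (hA.ne_zero k)
  have h : Ring.inverse x l * x l = 1 := congrFun (Ring.inverse_mul_cancel x hx) l
  rw [Matrix.inv_diagonal, Matrix.diagonal_apply_eq, norm_pos_iff]
  exact left_ne_zero_of_mul_eq_one h

/-- If row `k` of the perturbation of `A` is `O(P ^ (s + ρ j k))`, then row `m` of the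
perturbation of the inverse is `O(P ^ (s + ρ j m))`; in particular, its row `j` is `O(P ^ s)`. -/
theorem isBigO_inv_sub_inv (hρ : IsDistance ρ) (hA : IsLocalized ρ A x) (hB : IsLocalized ρ B y)
    {j : ι} {s : ℝ}
    (hAB : ∀ k i, (fun P => A P k i - B P k i) =O[atTop] fun P : ℝ => P ^ (s + ρ j k)) (m l : ι) :
    (fun P => (B P)⁻¹ m l - (A P)⁻¹ m l) =O[atTop] fun P : ℝ => P ^ (s + ρ j m) := by
  have h : (fun P => ∑ i, (∑ k, (B P)⁻¹ m k * (A P k i - B P k i)) * (A P)⁻¹ i l) =O[atTop]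
      fun P : ℝ => P ^ (s + ρ j m) := by
    refine isBigO_rpow_sum fun i _ => ?_
    refine isBigO_rpow_mul (isBigO_rpow_sum fun k _ => ?_)
      (isBigO_rpow_mono (hA.isBigO_inv hρ i l) (t := 0) ?_) (add_zero _)
    · refine isBigO_rpow_mono (isBigO_rpow_mul (hB.isBigO_inv hρ m k) (hAB k i) rfl) ?_
      have := hρ.triangle j m k
      linarith
    · by_cases hil : i = l
      · simp [hil, hρ.self]
      · linarith [hρ.pos i l hil]
  refine h.congr' ?_ EventuallyEq.rfl
  filter_upwards [hA.eventually_isUnit hρ, hB.eventually_isUnit hρ] with P hPA hPB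
  rw [← Matrix.sub_apply, Matrix.inv_sub_inv (iff_of_true hPB hPA), Matrix.mul_apply]
  simp only [Matrix.mul_apply, Matrix.sub_apply]

/-- The squared norm of column `l` of the inverse changes by `O(P ^ (s + ρ j l))`: the larger
perturbation of a row `m` is compensated by the decay of the entry `(m, l)`. -/
theorem isBigO_invColNorm_sq_sub (hρ : IsDistance ρ) (hA : IsLocalized ρ A x)
    (hB : IsLocalized ρ B y) {j : ι} {s : ℝ}
    (hAB : ∀ k i, (fun P => A P k i - B P k i) =O[atTop] fun P : ℝ => P ^ (s + ρ j k)) (l : ι) :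
    (fun P => ((invColNorm (A P) l ^ 2 - invColNorm (B P) l ^ 2 : ℝ) : ℂ)) =O[atTop]
      fun P : ℝ => P ^ (s + ρ j l) := by
  have key : ∀ P, ((invColNorm (A P) l ^ 2 - invColNorm (B P) l ^ 2 : ℝ) : ℂ) =
      ∑ m, (((‖(A P)⁻¹ m l‖ - ‖(B P)⁻¹ m l‖ : ℝ) : ℂ)) *
        ((‖(A P)⁻¹ m l‖ + ‖(B P)⁻¹ m l‖ : ℝ) : ℂ) := by
    intro P
    rw [invColNorm_sq, invColNorm_sq, ← Finset.sum_sub_distrib, Complex.ofReal_sum]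
    refine Finset.sum_congr rfl fun m _ => ?_
    rw [← Complex.ofReal_mul]
    congr 1
    ring
  simp only [key]
  refine isBigO_rpow_sum fun m _ => ?_
  have h1 : (fun P => ((‖(A P)⁻¹ m l‖ - ‖(B P)⁻¹ m l‖ : ℝ) : ℂ)) =O[atTop]
      fun P : ℝ => P ^ (s + ρ j m) := by
    refine IsBigO.trans (IsBigO.of_bound 1 (Eventually.of_forall fun P => ?_))
      (isBigO_inv_sub_inv hρ hA hB hAB m l)
    rw [Complex.norm_real, Real.norm_eq_abs, one_mul, norm_sub_rev]
    exact abs_norm_sub_norm_le _ _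
  have h2 : (fun P => ((‖(A P)⁻¹ m l‖ + ‖(B P)⁻¹ m l‖ : ℝ) : ℂ)) =O[atTop]
      fun P : ℝ => P ^ (-ρ m l) := by
    refine IsBigO.congr_left (f₁ := fun P => (‖(A P)⁻¹ m l‖ : ℂ) + (‖(B P)⁻¹ m l‖ : ℂ)) ?_
      (fun P => (Complex.ofReal_add _ _).symm)
    refine IsBigO.add ?_ ?_
    · exact IsBigO.of_norm_left (by simpa using hA.isBigO_inv hρ m l)
    · exact IsBigO.of_norm_left (by simpa using hB.isBigO_inv hρ m l)
  refine isBigO_rpow_mono (isBigO_rpow_mul h1 h2 rfl) ?_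
  have := hρ.triangle j l m
  rw [hρ.symm l m] at this
  linarith

/-- Stability of row `j` of the normalized inverse: if row `k` of the perturbation is
`O(P ^ (s + ρ j k))`, then the entries of row `j` of the normalized inverse change by
`O(P ^ s)`. -/
theorem isBigO_normalized_inv_sub (hρ : IsDistance ρ) (hA : IsLocalized ρ A x)
    (hB : IsLocalized ρ B y) {j : ι} {s : ℝ}
    (hAB : ∀ k i, (fun P => A P k i - B P k i) =O[atTop] fun P : ℝ => P ^ (s + ρ j k)) (l : ι) :
    (fun P => (B P)⁻¹ j l / (invColNorm (B P) l : ℂ) - (A P)⁻¹ j l / (invColNorm (A P) l : ℂ))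
      =O[atTop] fun P : ℝ => P ^ s := by
  have hNA := (Complex.continuous_ofReal.tendsto _).comp (hA.tendsto_invColNorm hρ l)
  have hNB := (Complex.continuous_ofReal.tendsto _).comp (hB.tendsto_invColNorm hρ l)
  have pA := hA.invColNorm_diagonal_pos l
  have pB := hB.invColNorm_diagonal_pos l
  set a := invColNorm (Matrix.diagonal x) l
  set b := invColNorm (Matrix.diagonal y) l
  -- The difference of the reciprocal norms is the difference of the squared norms divided by
  -- `a * b * (a + b)`, which has a nonzero limit.
  have hne : ((a : ℂ) * b * (a + b)) ≠ 0 := by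
    exact_mod_cast (by positivity : a * b * (a + b) ≠ 0)
  have hden := ((hNA.mul hNB).mul (hNA.add hNB)).inv₀ hne
  have h1 := isBigO_rpow_mul (isBigO_inv_sub_inv hρ hA hB hAB j l)
    (isBigO_rpow_of_tendsto (hNB.inv₀ (by exact_mod_cast pB.ne'))) (u := s)
    (by rw [hρ.self]; ring)
  have h2 := isBigO_rpow_mul (isBigO_rpow_mul (hA.isBigO_inv hρ j l)
    (isBigO_invColNorm_sq_sub hρ hA hB hAB l) (u := s) (by ring))
    (isBigO_rpow_of_tendsto hden) (add_zero _)
  refine (h1.add h2).congr' ?_ EventuallyEq.rfl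
  filter_upwards [(hA.tendsto_invColNorm hρ l).eventually_const_lt pA,
    (hB.tendsto_invColNorm hρ l).eventually_const_lt pB] with P hPA hPB
  have e1 : ((invColNorm (A P) l : ℝ) : ℂ) ≠ 0 := by exact_mod_cast hPA.ne'
  have e2 : ((invColNorm (B P) l : ℝ) : ℂ) ≠ 0 := by exact_mod_cast hPB.ne'
  have e3 : ((invColNorm (A P) l : ℝ) : ℂ) + (invColNorm (B P) l : ℝ) ≠ 0 := by
    exact_mod_cast (add_pos hPA hPB).ne'
  simp only [Function.comp_apply]
  push_cast
  field_simp
  ring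

end IsLocalized

/-! ### The SINR of distributed zero-forcing for fixed fading -/

/-- Up to a bounded error, the gains of distributed zero-forcing are those of zero-forcing with
the exact channel `H`: they vanish off the diagonal and are equal to `√P / ‖H⁻¹ eₗ‖` on it. -/
theorem isBigO_gain_sub {K : ℕ} {ρ : Fin K → Fin K → ℝ} (hρ : IsDistance ρ)
    {H : ℝ → Matrix (Fin K) (Fin K) ℂ} {E : Fin K → ℝ → Matrix (Fin K) (Fin K) ℂ}
    {x : Fin K → ℂ} {y : Fin K → Fin K → ℂ} (hH : IsLocalized ρ H x)
    (hE : ∀ j, IsLocalized ρ (E j) (y j))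
    (hHE : ∀ j k i, (fun P => H P k i - E j P k i) =O[atTop]
      fun P : ℝ => P ^ (-(1 / 2) + ρ j k)) (i l : Fin K) :
    (fun P => (H P * Matrix.of fun j l => zfPrecoder P (E j P) j l) i l -
      (√P : ℂ) * ((1 : Matrix (Fin K) (Fin K) ℂ) i l / (invColNorm (H P) l : ℂ))) =O[atTop]
      fun P : ℝ => P ^ (0 : ℝ) := by
  have hsqrt : (fun P : ℝ => (√P : ℂ)) =O[atTop] fun P : ℝ => P ^ (1 / 2 : ℝ) := by
    refine IsBigO.of_bound 1 (Eventually.of_forall fun P => ?_)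
    rw [Complex.norm_real, Real.sqrt_eq_rpow, one_mul]
  have h : (fun P => ∑ j, H P i j * ((√P : ℂ) * ((E j P)⁻¹ j l / (invColNorm (E j P) l : ℂ) -
      (H P)⁻¹ j l / (invColNorm (H P) l : ℂ)))) =O[atTop] fun P : ℝ => P ^ (0 : ℝ) := by
    refine isBigO_rpow_sum fun j _ => isBigO_rpow_mul (t := 0)
      (isBigO_rpow_mono (hH.decay i j) (t := 0) ?_)
      (isBigO_rpow_mul hsqrt (hH.isBigO_normalized_inv_sub hρ (hE j) (hHE j) l) (by norm_num))
      (add_zero _)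
    by_cases hij : i = j
    · simp [hij, hρ.self]
    · linarith [hρ.pos i j hij]
  refine h.congr' ?_ EventuallyEq.rfl
  filter_upwards [hH.eventually_isUnit hρ] with P hP
  rw [← Matrix.mul_nonsing_inv (H P) ((Matrix.isUnit_iff_isUnit_det _).1 hP)]
  simp only [Matrix.mul_apply, Matrix.of_apply, zfPrecoder]
  rw [Finset.sum_div, Finset.mul_sum, ← Finset.sum_sub_distrib]
  refine Finset.sum_congr rfl fun j _ => ?_
  change _ = H P i j * ((√P : ℂ) * ((E j P)⁻¹ j l / (invColNorm (E j P) l : ℂ))) - _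
  ring

/-- Bounded interference and a signal amplitude of order `√P` give an SINR of order `P`. -/
theorem eventually_mul_le_sinr_of_gain {K : ℕ} {H T : ℝ → Matrix (Fin K) (Fin K) ℂ} {i : Fin K}
    {b : ℝ} (hb : 0 < b)
    (hint : ∀ l, l ≠ i → (fun P => (H P * T P) i l) =O[atTop] fun _ => (1 : ℝ))
    (hsig : Tendsto (fun P => ‖(H P * T P) i i‖ / √P) atTop (𝓝 b)) :
    ∃ c : ℝ, 0 < c ∧ ∀ᶠ P in atTop, c * P ≤ sinr (H P) (T P) i := by
  have hsum : (fun P => ∑ l ∈ Finset.univ.erase i, ‖(H P * T P) i l‖ ^ 2) =O[atTop]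
      fun _ => (1 : ℝ) := by
    have h := IsBigO.sum (s := Finset.univ.erase i) (A := fun l P => ‖(H P * T P) i l‖ ^ 2)
      (g := fun _ : ℝ => (1 : ℝ)) (l := atTop)
      fun l hl => by simpa using (hint l (Finset.ne_of_mem_erase hl)).norm_left.pow 2
    rwa [Finset.sum_fn] at h
  -- `M` bounds the interference power, and half of the limiting signal amplitude is kept.
  obtain ⟨M, hM⟩ := hsum.bound
  have hM0 : 0 < 1 + |M| := by positivity
  refine ⟨(b / 2) ^ 2 / (1 + |M|), by positivity, ?_⟩
  filter_upwards [hM, eventually_gt_atTop 0,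
    hsig.eventually_const_lt (half_lt_self hb)] with P hMP hP hsP
  rw [lt_div_iff₀ (Real.sqrt_pos.2 hP)] at hsP
  have hS : 0 ≤ ∑ l ∈ Finset.univ.erase i, ‖(H P * T P) i l‖ ^ 2 :=
    Finset.sum_nonneg fun _ _ => sq_nonneg _
  rw [norm_one, mul_one, Real.norm_of_nonneg hS] at hMP
  rw [sinr]
  generalize ∑ l ∈ Finset.univ.erase i, ‖(H P * T P) i l‖ ^ 2 = S at hMP hS ⊢
  generalize ‖(H P * T P) i i‖ = t at hsP ⊢
  have hnum : (b / 2) ^ 2 * P ≤ t ^ 2 := by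
    calc (b / 2) ^ 2 * P = (b / 2 * √P) ^ 2 := by rw [mul_pow, Real.sq_sqrt hP.le]
      _ ≤ t ^ 2 := by gcongr
  have hden : 1 + S ≤ 1 + |M| := by linarith [le_abs_self M]
  rw [div_mul_eq_mul_div]
  exact div_le_div₀ (sq_nonneg t) hnum (by linarith) hden

theorem eventually_mul_le_sinr {K : ℕ} {ρ : Fin K → Fin K → ℝ} (hρ : IsDistance ρ)
    {H : ℝ → Matrix (Fin K) (Fin K) ℂ} {E : Fin K → ℝ → Matrix (Fin K) (Fin K) ℂ}
    {x : Fin K → ℂ} {y : Fin K → Fin K → ℂ} (hH : IsLocalized ρ H x)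
    (hE : ∀ j, IsLocalized ρ (E j) (y j))
    (hHE : ∀ j k i, (fun P => H P k i - E j P k i) =O[atTop]
      fun P : ℝ => P ^ (-(1 / 2) + ρ j k)) (i : Fin K) :
    ∃ c : ℝ, 0 < c ∧ ∀ᶠ P in atTop,
      c * P ≤ sinr (H P) (Matrix.of fun j l => zfPrecoder P (E j P) j l) i := by
  have hgain := isBigO_gain_sub hρ hH hE hHE i
  generalize hT : (fun P : ℝ => Matrix.of fun j l => zfPrecoder P (E j P) j l) = T
  replace hT : ∀ P, (Matrix.of fun j l => zfPrecoder P (E j P) j l) = T P := congrFun hT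
  simp only [hT, Real.rpow_zero] at hgain ⊢
  have hpos := hH.invColNorm_diagonal_pos i
  have hN := hH.tendsto_invColNorm hρ i
  generalize invColNorm (Matrix.diagonal x) i = a at hpos hN
  refine eventually_mul_le_sinr_of_gain (inv_pos.2 hpos) (fun l hl => ?_) ?_
  · simpa [Matrix.one_apply_ne hl.symm] using hgain l
  have hsmall : Tendsto (fun P : ℝ => ((H P * T P) i i -
      (√P : ℂ) * (1 / (invColNorm (H P) i : ℂ))) * ((√P)⁻¹ : ℝ)) atTop (𝓝 0) := by
    have h1 := hgain i
    simp only [Matrix.one_apply_eq] at h1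
    have h2 : Tendsto (fun P : ℝ => (√P)⁻¹) atTop (𝓝 0) :=
      tendsto_inv_atTop_zero.comp Real.tendsto_sqrt_atTop
    refine (h1.mul (isBigO_refl (fun P : ℝ => (((√P)⁻¹ : ℝ) : ℂ)) atTop).norm_right).trans_tendsto
      ?_
    simpa using h2.norm
  have h3 : Tendsto (fun P => (1 : ℂ) / (invColNorm (H P) i : ℂ)) atTop (𝓝 (1 / a)) :=
    tendsto_const_nhds.div ((Complex.continuous_ofReal.tendsto _).comp hN)
      (by exact_mod_cast hpos.ne')
  have h4 := (hsmall.add h3).norm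
  rw [zero_add, norm_div, norm_one, Complex.norm_real, Real.norm_of_nonneg hpos.le,
    one_div] at h4
  refine h4.congr' ?_
  filter_upwards [eventually_gt_atTop 0] with P hP
  have hs : (√P : ℂ) ≠ 0 := by exact_mod_cast (Real.sqrt_pos.2 hP).ne'
  have hdiv : ‖(H P * T P) i i‖ / √P = ‖(H P * T P) i i / (√P : ℂ)‖ := by
    rw [norm_div, Complex.norm_real, Real.norm_of_nonneg (Real.sqrt_nonneg P)]
  rw [hdiv]
  congr 1
  push_cast
  field_simp
  ring

theorem sinr_nonneg {K : ℕ} (H T : Matrix (Fin K) (Fin K) ℂ) (i : Fin K) : 0 ≤ sinr H T i := by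
  unfold sinr
  positivity

/-- Every entry of a zero-forcing precoder has modulus at most `√P`. If the column of the inverse
is zero, then so is the entry, by the convention for division by zero. -/
theorem norm_zfPrecoder_apply_le {K : ℕ} (P : ℝ) (A : Matrix (Fin K) (Fin K) ℂ) (m i : Fin K) :
    ‖zfPrecoder P A m i‖ ≤ √P := by
  have h : ‖A⁻¹ m i / (invColNorm A i : ℂ)‖ ≤ 1 := by
    rw [norm_div, Complex.norm_real]
    exact div_le_one_of_le₀ ((norm_inv_apply_le_invColNorm A m i).trans (le_abs_self _))
      (norm_nonneg _)
  calc ‖zfPrecoder P A m i‖ = √P * ‖A⁻¹ m i / (invColNorm A i : ℂ)‖ := by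
        rw [zfPrecoder, Matrix.of_apply, norm_mul, Complex.norm_real,
          Real.norm_of_nonneg (Real.sqrt_nonneg P), invColNorm]
    _ ≤ √P * 1 := by gcongr
    _ = √P := mul_one _

theorem sinr_le_of_norm_le {K : ℕ} {P : ℝ} (hP : 0 ≤ P) {H T : Matrix (Fin K) (Fin K) ℂ}
    {g : Fin K → Fin K → ℂ} (hH : ∀ k i, ‖H k i‖ ≤ ‖g k i‖) (hT : ∀ j l, ‖T j l‖ ≤ √P)
    (i : Fin K) : sinr H T i ≤ P * (K * ∑ j, ‖g i j‖ ^ 2) := by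
  have h1 : ‖(H * T) i i‖ ≤ (∑ j, ‖g i j‖) * √P := by
    rw [Matrix.mul_apply, Finset.sum_mul]
    refine norm_sum_le_of_le _ fun j _ => ?_
    rw [norm_mul]
    exact mul_le_mul (hH i j) (hT j i) (norm_nonneg _) (norm_nonneg _)
  have h2 : (∑ j, ‖g i j‖) ^ 2 ≤ K * ∑ j, ‖g i j‖ ^ 2 := by
    simpa using sq_sum_le_card_mul_sum_sq (s := Finset.univ) (f := fun j => ‖g i j‖)
  have h3 : 0 ≤ ∑ l ∈ Finset.univ.erase i, ‖(H * T) i l‖ ^ 2 := by positivity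
  calc sinr H T i ≤ ‖(H * T) i i‖ ^ 2 := div_le_self (by positivity) (by linarith)
    _ ≤ ((∑ j, ‖g i j‖) * √P) ^ 2 := by gcongr
    _ = P * (∑ j, ‖g i j‖) ^ 2 := by rw [mul_pow, Real.sq_sqrt hP]; ring
    _ ≤ _ := by gcongr

/-! ### The estimates of the distance-based allocation -/

section Allocation

variable {K : ℕ} {γ : ℝ} {pos : Fin K → EuclideanSpace ℝ (Fin 2)}

/-- The distance between the pairs `k` and `i`, scaled so that the amplitude of the link is
`P ^ (-scaledDist γ pos k i)`. -/
def scaledDist (γ : ℝ) (pos : Fin K → EuclideanSpace ℝ (Fin 2)) (k i : Fin K) : ℝ :=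
  (1 - γ) / 2 * dist (pos k) (pos i)

theorem isDistance_scaledDist (hpos : Function.Injective pos) (hγ : γ < 1) :
    IsDistance (scaledDist γ pos) where
  self i := by simp [scaledDist]
  symm i k := by rw [scaledDist, scaledDist, dist_comm]
  triangle i k l := by
    simp only [scaledDist, ← mul_add]
    exact mul_le_mul_of_nonneg_left (dist_triangle _ _ _) (by linarith)
  pos i k hik := mul_pos (by linarith) (dist_pos.2 (hpos.ne hik))

theorem scaledDist_nonneg (hγ : γ < 1) (k i : Fin K) : 0 ≤ scaledDist γ pos k i :=
  mul_nonneg (by linarith) dist_nonneg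

theorem amplitude_eq_rpow {P : ℝ} (hP : 0 < P) (k i : Fin K) :
    amplitude (interferenceLevel γ pos) P k i = P ^ (-scaledDist γ pos k i) := by
  rw [amplitude, Real.sqrt_eq_rpow, ← Real.rpow_mul hP.le]
  congr 1
  simp only [interferenceLevel, Matrix.of_apply, scaledDist]
  ring

theorem amplitude_le_one (hγ : γ < 1) {P : ℝ} (hP : 1 ≤ P) (k i : Fin K) :
    amplitude (interferenceLevel γ pos) P k i ≤ 1 := by
  rw [amplitude_eq_rpow (by linarith)]
  exact Real.rpow_le_one_of_one_le_of_nonpos hP (neg_nonpos.2 (scaledDist_nonneg hγ k i))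

theorem amplitude_nonneg (Γ : Matrix (Fin K) (Fin K) ℝ) (P : ℝ) (k i : Fin K) :
    0 ≤ amplitude Γ P k i :=
  Real.sqrt_nonneg _

theorem norm_channel_apply_le (hγ : γ < 1) {P : ℝ} (hP : 1 ≤ P) (ht : Fin K → Fin K → ℂ)
    (k i : Fin K) : ‖channel (interferenceLevel γ pos) P ht k i‖ ≤ ‖ht k i‖ := by
  rw [channel, Matrix.of_apply, norm_mul, Complex.norm_real,
    Real.norm_of_nonneg (amplitude_nonneg _ _ _ _)]
  exact mul_le_of_le_one_left (norm_nonneg _) (amplitude_le_one hγ hP k i)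

theorem isBigO_amplitude (k i : Fin K) :
    (fun P => (amplitude (interferenceLevel γ pos) P k i : ℂ)) =O[atTop]
      fun P : ℝ => P ^ (-scaledDist γ pos k i) := by
  refine IsBigO.of_bound 1 ?_
  filter_upwards [eventually_gt_atTop 0] with P hP
  rw [Complex.norm_real, amplitude_eq_rpow hP, one_mul]

theorem amplitude_self {P : ℝ} (hP : 0 < P) (k : Fin K) :
    amplitude (interferenceLevel γ pos) P k k = 1 := by
  rw [amplitude_eq_rpow hP, scaledDist, dist_self, mul_zero, neg_zero, Real.rpow_zero]

theorem isLocalized_channel {ht : Fin K → Fin K → ℂ} (hne : ∀ k, ht k k ≠ 0) :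
    IsLocalized (scaledDist γ pos) (fun P => channel (interferenceLevel γ pos) P ht)
      (fun k => ht k k) where
  decay k i := isBigO_rpow_mul (isBigO_amplitude k i)
    (isBigO_rpow_of_tendsto (tendsto_const_nhds (x := ht k i))) (add_zero _)
  tendsto_diag k := by
    refine tendsto_const_nhds.congr' ?_
    filter_upwards [eventually_gt_atTop 0] with P hP
    simp [channel, amplitude_self hP]
  ne_zero := hne

/-- The standard deviation, relative to the pathloss, of the estimation error that TX `j` makes on
the coefficient `(k, i)`. -/
def errorScale (γ : ℝ) (pos : Fin K → EuclideanSpace ℝ (Fin 2)) (P : ℝ) (j k i : Fin K) : ℝ :=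
  √((2 : ℝ) ^ (-(distanceAllocation γ pos P j k i : ℝ)))

/-- The exponent of the bit budget of TX `j` for the coefficient `(k, i)`, in terms of the scaled
distance. -/
theorem allocation_exponent_eq (j k i : Fin K) :
    1 + (γ - 1) * (dist (pos j) (pos k) + dist (pos k) (pos i)) =
      1 - 2 * (scaledDist γ pos j k + scaledDist γ pos k i) := by
  simp only [scaledDist]
  ring

theorem errorScale_le_rpow {P : ℝ} (hP : 1 ≤ P) (j k i : Fin K) :
    errorScale γ pos P j k i ≤
      P ^ (-(max (1 - 2 * (scaledDist γ pos j k + scaledDist γ pos k i)) 0 / 2)) := by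
  have hP0 : 0 < P := by linarith
  set e := max (1 - 2 * (scaledDist γ pos j k + scaledDist γ pos k i)) 0
  have hb : e * Real.logb 2 P ≤ (distanceAllocation γ pos P j k i : ℝ) := by
    simp only [distanceAllocation, Matrix.of_apply, allocation_exponent_eq, NNReal.coe_natCast]
    exact Nat.le_ceil _
  calc errorScale γ pos P j k i ≤ √((2 : ℝ) ^ (-(e * Real.logb 2 P))) := by
        unfold errorScale
        gcongr
        norm_num
    _ = √(P ^ (-e)) := by
        rw [show -(e * Real.logb 2 P) = Real.logb 2 P * (-e) by ring, Real.rpow_mul (by norm_num),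
          Real.rpow_logb (by norm_num) (by norm_num) hP0]
    _ = P ^ (-(e / 2)) := by
        rw [Real.sqrt_eq_rpow, ← Real.rpow_mul hP0.le]
        congr 1
        ring

theorem errorScale_nonneg (P : ℝ) (j k i : Fin K) : 0 ≤ errorScale γ pos P j k i :=
  Real.sqrt_nonneg _

theorem isBigO_errorScale (j k i : Fin K) {s : ℝ}
    (hs : s ≤ max (1 - 2 * (scaledDist γ pos j k + scaledDist γ pos k i)) 0 / 2) :
    (fun P => (errorScale γ pos P j k i : ℂ)) =O[atTop] fun P : ℝ => P ^ (-s) := by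
  refine isBigO_rpow_mono (s := -(max (1 - 2 * (scaledDist γ pos j k +
    scaledDist γ pos k i)) 0 / 2)) (IsBigO.of_bound 1 ?_) (neg_le_neg hs)
  filter_upwards [eventually_ge_atTop 1] with P hP
  rw [Complex.norm_real, Real.norm_of_nonneg (errorScale_nonneg _ _ _ _), one_mul]
  exact (errorScale_le_rpow hP j k i).trans (le_abs_self _)

/-- The relative error of TX `j` on a diagonal coefficient vanishes in the limit, unless TX `j` is
so far away that it is given no bits. -/
theorem tendsto_errorScale (j k : Fin K) :
    Tendsto (fun P => errorScale γ pos P j k k) atTop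
      (𝓝 (if 1 ≤ 2 * scaledDist γ pos j k then 1 else 0)) := by
  have hkk : scaledDist γ pos k k = 0 := by rw [scaledDist, dist_self, mul_zero]
  split_ifs with h
  · have hb : ∀ P, errorScale γ pos P j k k = 1 := by
      intro P
      simp only [errorScale, distanceAllocation, Matrix.of_apply, allocation_exponent_eq]
      rw [hkk, max_eq_right (by linarith)]
      simp
    simp only [hb]
    exact tendsto_const_nhds
  · push Not at h
    have he : 0 < max (1 - 2 * (scaledDist γ pos j k + scaledDist γ pos k k)) 0 / 2 := by
      rw [hkk, max_eq_left (by linarith)]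
      linarith
    refine squeeze_zero' (Eventually.of_forall fun P => errorScale_nonneg P j k k) ?_
      (tendsto_rpow_neg_atTop he)
    filter_upwards [eventually_ge_atTop 1] with P hP
    exact errorScale_le_rpow hP j k k

theorem channelEstimate_apply (ht dt : Fin K → Fin K → ℂ) (P : ℝ) (j k i : Fin K) :
    channelEstimate (interferenceLevel γ pos) P (distanceAllocation γ pos P j) ht dt k i =
      amplitude (interferenceLevel γ pos) P k i * (ht k i + errorScale γ pos P j k i * dt k i) := by
  simp only [channelEstimate, Matrix.of_apply, errorScale]
  push_cast
  ring

theorem isLocalized_channelEstimate {ht dt : Fin K → Fin K → ℂ} (j : Fin K)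
    (hne : ∀ k, ht k k ≠ 0) (hne' : ∀ k, ht k k + dt k k ≠ 0) :
    IsLocalized (scaledDist γ pos)
      (fun P => channelEstimate (interferenceLevel γ pos) P (distanceAllocation γ pos P j) ht dt)
      (fun k => ht k k + ((if 1 ≤ 2 * scaledDist γ pos j k then 1 else 0 : ℝ) : ℂ) * dt k k) where
  decay k i := by
    simp only [channelEstimate_apply]
    refine isBigO_rpow_mul (isBigO_amplitude k i) (IsBigO.add
      (isBigO_rpow_of_tendsto (tendsto_const_nhds (x := ht k i)))
      (isBigO_rpow_mul (s := 0) ?_ (isBigO_rpow_of_tendsto (tendsto_const_nhds (x := dt k i)))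
        (add_zero _))) (add_zero _)
    have h := isBigO_errorScale (γ := γ) (pos := pos) j k i
      (div_nonneg (le_max_right _ _) (by norm_num))
    rwa [neg_zero] at h
  tendsto_diag k := by
    simp only [channelEstimate_apply]
    refine (tendsto_const_nhds.add (((Complex.continuous_ofReal.tendsto _).comp
      (tendsto_errorScale j k)).mul_const (dt k k))).congr' ?_
    filter_upwards [eventually_gt_atTop 0] with P hP
    simp [amplitude_self hP]
  ne_zero k := by
    split_ifs
    · simpa using hne' k
    · simpa using hne k

/-- The allocation makes the absolute error of TX `j` on row `k` small enough for the stability of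
row `j` of the normalized inverse. -/
theorem isBigO_channel_sub_channelEstimate (ht dt : Fin K → Fin K → ℂ) (j k i : Fin K) :
    (fun P => channel (interferenceLevel γ pos) P ht k i -
      channelEstimate (interferenceLevel γ pos) P (distanceAllocation γ pos P j) ht dt k i)
      =O[atTop] fun P : ℝ => P ^ (-(1 / 2) + scaledDist γ pos j k) := by
  have h := isBigO_rpow_mul (isBigO_amplitude (γ := γ) (pos := pos) k i) (isBigO_rpow_mul
    (isBigO_errorScale (γ := γ) (pos := pos) j k i le_rfl)
    (isBigO_rpow_of_tendsto (tendsto_const_nhds (x := dt k i))) (add_zero _)) rfl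
  have hle := le_max_left (1 - 2 * (scaledDist γ pos j k + scaledDist γ pos k i)) 0
  refine (isBigO_rpow_mono h.neg_left (by linarith)).congr_left fun P => ?_
  simp only [channelEstimate_apply, channel, Matrix.of_apply]
  ring

theorem eventually_mul_le_sinr_distributedPrecoder (hpos : Function.Injective pos) (hγ : γ < 1)
    {ht : Fin K → Fin K → ℂ} {dt : Fin K → Fin K → Fin K → ℂ} (hne : ∀ k, ht k k ≠ 0)
    (hne' : ∀ j k, ht k k + dt j k k ≠ 0) (i : Fin K) :
    ∃ c : ℝ, 0 < c ∧ ∀ᶠ P in atTop, c * P ≤ sinr (channel (interferenceLevel γ pos) P ht)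
      (distributedPrecoder (interferenceLevel γ pos) P (distanceAllocation γ pos P) ht dt) i := by
  simp only [distributedPrecoder]
  exact eventually_mul_le_sinr (isDistance_scaledDist hpos hγ) (isLocalized_channel hne)
    (fun j => isLocalized_channelEstimate j hne (hne' j))
    (fun j => isBigO_channel_sub_channelEstimate ht (dt j) j) i

theorem sinr_distributedPrecoder_le (hγ : γ < 1) {P : ℝ} (hP : 1 ≤ P)
    (b : Fin K → Matrix (Fin K) (Fin K) ℝ≥0) (ht : Fin K → Fin K → ℂ)
    (dt : Fin K → Fin K → Fin K → ℂ) (i : Fin K) :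
    sinr (channel (interferenceLevel γ pos) P ht)
      (distributedPrecoder (interferenceLevel γ pos) P b ht dt) i ≤
      P * (K * ∑ j, ‖ht i j‖ ^ 2) := by
  refine sinr_le_of_norm_le (by linarith) (norm_channel_apply_le hγ hP ht) (fun j l => ?_) i
  rw [distributedPrecoder, Matrix.of_apply]
  exact norm_zfPrecoder_apply_le P _ j l

/-! ### The logarithmic growth of the rate -/

theorem logb_one_add_mul_le {P X : ℝ} (hP : 1 ≤ P) (hX : 0 ≤ X) :
    Real.logb 2 (1 + P * X) ≤ Real.logb 2 P + X / Real.log 2 := by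
  have hl : 0 < Real.log 2 := Real.log_pos (by norm_num)
  rw [Real.logb, Real.logb, ← add_div]
  gcongr
  have h1 : Real.log (1 + P * X) ≤ Real.log (P * (1 + X)) :=
    Real.log_le_log (by positivity) (by nlinarith)
  rw [Real.log_mul (by positivity) (by positivity)] at h1
  linarith [Real.log_le_sub_one_of_pos (show 0 < 1 + X by positivity)]

theorem tendsto_logb_two_atTop : Tendsto (fun P : ℝ => Real.logb 2 P) atTop atTop :=
  Real.tendsto_logb_atTop (by norm_num)

theorem tendsto_logb_one_add_div_logb {S : ℝ → ℝ} {c X : ℝ} (hc : 0 < c) (hX : 0 ≤ X)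
    (hlow : ∀ᶠ P in atTop, c * P ≤ S P) (hup : ∀ᶠ P in atTop, S P ≤ P * X) :
    Tendsto (fun P => Real.logb 2 (1 + S P) / Real.logb 2 P) atTop (𝓝 1) := by
  have hlim : ∀ C : ℝ, Tendsto (fun P : ℝ => 1 + C / Real.logb 2 P) atTop (𝓝 1) := by
    intro C
    simpa using tendsto_const_nhds.add (tendsto_logb_two_atTop.const_div_atTop C)
  refine tendsto_of_tendsto_of_tendsto_of_le_of_le' (hlim (Real.logb 2 c))
    (hlim (X / Real.log 2)) ?_ ?_
  · filter_upwards [hlow, eventually_gt_atTop 1] with P h hP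
    have hl : 0 < Real.logb 2 P := Real.logb_pos (by norm_num) hP
    rw [le_div_iff₀ hl, add_mul, one_mul, div_mul_cancel₀ _ hl.ne', add_comm,
      ← Real.logb_mul hc.ne' (by positivity)]
    exact Real.logb_le_logb_of_le (by norm_num) (by positivity) (by linarith)
  · filter_upwards [hlow, hup, eventually_gt_atTop 1] with P h h' hP
    have hl : 0 < Real.logb 2 P := Real.logb_pos (by norm_num) hP
    have h0 : 0 ≤ c * P := by positivity
    rw [div_le_iff₀ hl, add_mul, one_mul, div_mul_cancel₀ _ hl.ne']
    refine le_trans ?_ (logb_one_add_mul_le hP.le hX)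
    exact Real.logb_le_logb_of_le (by norm_num) (by linarith) (by linarith)

end Allocation

/-! ### The complex Gaussian law -/

theorem measurable_complexOfRealPair :
    Measurable fun p : ℝ × ℝ => (p.1 : ℂ) + (p.2 : ℂ) * Complex.I := by
  fun_prop

instance : IsProbabilityMeasure complexGaussian :=
  Measure.isProbabilityMeasure_map measurable_complexOfRealPair.aemeasurable

theorem complexGaussian_singleton (z : ℂ) : complexGaussian {z} = 0 := by
  have : NullSingletonClass (gaussianReal 0 (1 / 2)) :=
    nullSingletonClass_gaussianReal (by norm_num)
  rw [complexGaussian, Measure.map_apply measurable_complexOfRealPair (measurableSet_singleton z)]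
  refine measure_mono_null (t := {z.re} ×ˢ Set.univ) ?_ ?_
  · rintro p hp
    have h := congrArg Complex.re (Set.mem_singleton_iff.1 hp)
    simpa using h
  · rw [Measure.prod_prod, measure_singleton, zero_mul]

theorem integrable_norm_sq_complexGaussian :
    Integrable (fun z : ℂ => ‖z‖ ^ 2) complexGaussian := by
  have hsq : Integrable (fun x : ℝ => x ^ 2) (gaussianReal 0 (1 / 2)) :=
    (memLp_id_gaussianReal 2).integrable_sq
  rw [complexGaussian, integrable_map_measure (by fun_prop)
    measurable_complexOfRealPair.aemeasurable]
  refine ((hsq.comp_fst _).add (hsq.comp_snd _)).congr (Eventually.of_forall fun p => ?_)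
  simp only [Pi.add_apply, Function.comp_apply, ← Complex.normSq_eq_norm_sq, Complex.normSq_apply]
  simp
  ring

/-- The sum of two independent standard complex Gaussians is almost surely nonzero. -/
theorem ae_prod_add_ne_zero : ∀ᵐ p ∂complexGaussian.prod complexGaussian, p.1 + p.2 ≠ 0 := by
  have hs : MeasurableSet {p : ℂ × ℂ | p.1 + p.2 = 0} :=
    measurableSet_eq_fun (by fun_prop) measurable_const
  have h : (complexGaussian.prod complexGaussian) {p : ℂ × ℂ | p.1 + p.2 = 0} = 0 := by
    rw [Measure.measure_prod_null hs]
    refine Eventually.of_forall fun z => ?_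
    have hz : Prod.mk z ⁻¹' {p : ℂ × ℂ | p.1 + p.2 = 0} = {-z} := by
      ext w
      simp [eq_neg_iff_add_eq_zero, add_comm]
    simp only [hz, complexGaussian_singleton, Pi.zero_apply]
  rw [ae_iff]
  simpa using h

/-! ### Measurability of the SINR -/

section Measurability

variable {K : ℕ} {Ω : Type*} [MeasurableSpace Ω]

theorem measurable_matrix_inv_apply {A : Ω → Matrix (Fin K) (Fin K) ℂ}
    (hA : ∀ k i, Measurable fun ω => A ω k i) (m l : Fin K) :
    Measurable fun ω => (A ω)⁻¹ m l := by
  have hdet : ∀ {M : Ω → Matrix (Fin K) (Fin K) ℂ}, (∀ k i, Measurable fun ω => M ω k i) →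
      Measurable fun ω => (M ω).det := by
    intro M hM
    simp only [Matrix.det_apply, Units.smul_def, zsmul_eq_mul]
    exact Finset.measurable_sum _ fun τ _ => (Finset.measurable_prod _ fun i _ =>
      hM (τ i) i).const_mul _
  simp only [Matrix.inv_def, Ring.inverse_eq_inv', Matrix.smul_apply, smul_eq_mul,
    Matrix.adjugate_apply]
  refine (hdet hA).inv.mul (hdet fun k i => ?_)
  by_cases hk : k = l
  · subst hk
    simp only [Matrix.updateRow_self]
    exact measurable_const
  · simpa only [Matrix.updateRow_ne hk] using hA k i

theorem measurable_zfPrecoder_apply {A : Ω → Matrix (Fin K) (Fin K) ℂ}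
    (hA : ∀ k i, Measurable fun ω => A ω k i) (P : ℝ) (m l : Fin K) :
    Measurable fun ω => zfPrecoder P (A ω) m l := by
  simp only [zfPrecoder, Matrix.of_apply, EuclideanSpace.norm_eq]
  have h := measurable_matrix_inv_apply hA
  exact ((h m l).div (Complex.measurable_ofReal.comp
    (Finset.measurable_sum _ fun k _ => ((h k l).norm.pow_const 2)).sqrt)).const_mul _

theorem measurable_sinr {H T : Ω → Matrix (Fin K) (Fin K) ℂ}
    (hH : ∀ k i, Measurable fun ω => H ω k i) (hT : ∀ k i, Measurable fun ω => T ω k i)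
    (i : Fin K) : Measurable fun ω => sinr (H ω) (T ω) i := by
  have h : ∀ l, Measurable fun ω => (H ω * T ω) i l := by
    intro l
    simp only [Matrix.mul_apply]
    exact Finset.measurable_sum _ fun j _ => (hH i j).mul (hT j l)
  exact ((h i).norm.pow_const 2).div (measurable_const.add
    (Finset.measurable_sum _ fun l _ => (h l).norm.pow_const 2))

end Measurability

/-! ### The Rayleigh model -/

namespace IsRayleighModel

variable {K : ℕ} {Ω : Type*} [MeasurableSpace Ω] {Pr : Measure Ω}
  {Ht : Fin K → Fin K → Ω → ℂ} {Dt : Fin K → Fin K → Fin K → Ω → ℂ}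

theorem ae_channel_ne_zero (h : IsRayleighModel Pr Ht Dt) (k : Fin K) :
    ∀ᵐ ω ∂Pr, Ht k k ω ≠ 0 := by
  have h0 : ∀ᵐ z ∂Pr.map (Ht k k), z ≠ 0 := by
    rw [h.law_channel, ae_iff]
    simpa using complexGaussian_singleton 0
  exact ae_of_ae_map (h.measurable_channel k k).aemeasurable h0

theorem ae_channel_add_error_ne_zero [IsProbabilityMeasure Pr] (h : IsRayleighModel Pr Ht Dt)
    (j k : Fin K) : ∀ᵐ ω ∂Pr, Ht k k ω + Dt j k k ω ≠ 0 := by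
  have hind : IndepFun (Ht k k) (Dt j k k) Pr :=
    (h.indep_error_channel.comp (measurable_pi_apply (j, k, k)) (measurable_pi_apply (k, k))).symm
  have hm := h.measurable_channel k k
  have hm' := h.measurable_error j k k
  have hlaw := (indepFun_iff_map_prod_eq_prod_map_map hm.aemeasurable hm'.aemeasurable).1 hind
  rw [h.law_channel, h.law_error] at hlaw
  have h0 := ae_prod_add_ne_zero
  rw [← hlaw] at h0
  exact ae_of_ae_map (hm.prodMk hm').aemeasurable h0

theorem integrable_norm_sq_channel (h : IsRayleighModel Pr Ht Dt) (k i : Fin K) :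
    Integrable (fun ω => ‖Ht k i ω‖ ^ 2) Pr := by
  have h0 := integrable_norm_sq_complexGaussian
  rw [← h.law_channel k i] at h0
  exact h0.comp_measurable (h.measurable_channel k i)

theorem measurable_sinr (h : IsRayleighModel Pr Ht Dt) (Γ : Matrix (Fin K) (Fin K) ℝ) (P : ℝ)
    (b : Fin K → Matrix (Fin K) (Fin K) ℝ≥0) (i : Fin K) :
    Measurable fun ω => sinr (channel Γ P fun k l => Ht k l ω)
      (distributedPrecoder Γ P b (fun k l => Ht k l ω) fun j k l => Dt j k l ω) i := by
  have hH : ∀ k l, Measurable fun ω => channel Γ P (fun k l => Ht k l ω) k l := fun k l => by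
    simp only [channel, Matrix.of_apply]
    exact (h.measurable_channel k l).const_mul _
  have hE : ∀ j k l, Measurable fun ω =>
      channelEstimate Γ P (b j) (fun k l => Ht k l ω) (fun k l => Dt j k l ω) k l := fun j k l => by
    simp only [channelEstimate, Matrix.of_apply]
    exact ((h.measurable_channel k l).const_mul _).add ((h.measurable_error j k l).const_mul _)
  have hT : ∀ j l, Measurable fun ω => distributedPrecoder Γ P b (fun k l => Ht k l ω)
      (fun j k l => Dt j k l ω) j l := fun j l => by
    have hrow : ∀ ω, distributedPrecoder Γ P b (fun k l => Ht k l ω) (fun j k l => Dt j k l ω) j l =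
        zfPrecoder P (channelEstimate Γ P (b j) (fun k l => Ht k l ω) fun k l => Dt j k l ω) j l :=
      fun ω => by rw [distributedPrecoder, Matrix.of_apply]
    simp only [hrow]
    exact measurable_zfPrecoder_apply (hE j) P j l
  exact SpatialCSIT.measurable_sinr hH hT i

end IsRayleighModel

end SpatialCSIT

end

open SpatialCSIT in
theorem theorem1 {K : ℕ} {Ω : Type*} [MeasurableSpace Ω]
    (Pr : MeasureTheory.Measure Ω) [MeasureTheory.IsProbabilityMeasure Pr]
    (Ht : Fin K → Fin K → Ω → ℂ) (Dt : Fin K → Fin K → Fin K → Ω → ℂ)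
    (hmodel : SpatialCSIT.IsRayleighModel Pr Ht Dt)
    (pos : Fin K → EuclideanSpace ℝ (Fin 2)) (hpos : Function.Injective pos)
    (γ : ℝ) (hγ : γ < 1) :
    SpatialCSIT.distanceAllocation γ pos ∈
      SpatialCSIT.dofAchieving Pr Ht Dt (SpatialCSIT.interferenceLevel γ pos) := by
  intro i
  have hlog2 : 0 < Real.log 2 := Real.log_pos (by norm_num)
  set X : Ω → ℝ := fun ω => K * ∑ j, ‖Ht i j ω‖ ^ 2
  have hX : ∀ ω, 0 ≤ X ω := fun ω =>
    mul_nonneg (Nat.cast_nonneg K) (Finset.sum_nonneg fun _ _ => sq_nonneg _)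
  have hXint : Integrable X Pr :=
    (integrable_finsetSum _ fun j _ => hmodel.integrable_norm_sq_channel i j).const_mul _
  set S : ℝ → Ω → ℝ := fun P ω =>
    sinr (channel (interferenceLevel γ pos) P fun k l => Ht k l ω)
      (distributedPrecoder (interferenceLevel γ pos) P (distanceAllocation γ pos P)
        (fun k l => Ht k l ω) fun j k l => Dt j k l ω) i
  have hS0 : ∀ P ω, 0 ≤ S P ω := fun P ω => sinr_nonneg _ _ i
  have hSm : ∀ P, Measurable (S P) := fun P => hmodel.measurable_sinr _ P _ i
  have hSle : ∀ P, 1 ≤ P → ∀ ω, S P ω ≤ P * X ω := fun P hP ω =>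
    sinr_distributedPrecoder_le hγ hP _ _ _ i
  have hSge : ∀ᵐ ω ∂Pr, ∃ c : ℝ, 0 < c ∧ ∀ᶠ P in atTop, c * P ≤ S P ω := by
    filter_upwards [ae_all_iff.2 hmodel.ae_channel_ne_zero,
      ae_all_iff.2 fun j => ae_all_iff.2 (hmodel.ae_channel_add_error_ne_zero j)] with ω h1 h2
    exact eventually_mul_le_sinr_distributedPrecoder hpos hγ h1 h2 i
  have hrate : ∀ P, ergodicRate Pr Ht Dt (interferenceLevel γ pos) (distanceAllocation γ pos) P i =
      ∫ ω, Real.logb 2 (1 + S P ω) ∂Pr := fun P => rfl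
  unfold HasGeneralizedDoF
  simp only [hrate, ← integral_div]
  clear_value S X
  have hlim : Tendsto (fun P => ∫ ω, Real.logb 2 (1 + S P ω) / Real.logb 2 P ∂Pr) atTop
      (𝓝 (∫ _, (1 : ℝ) ∂Pr)) := by
    refine tendsto_integral_filter_of_dominated_convergence (fun ω => 1 + X ω / Real.log 2)
      (Eventually.of_forall fun P => ?_) ?_ ((integrable_const 1).add (hXint.div_const _)) ?_
    · exact (((Real.measurable_log.comp (measurable_const.add (hSm P))).div_const _).div_const
        _).aestronglyMeasurable
    · filter_upwards [eventually_ge_atTop 2] with P hP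
      refine Eventually.of_forall fun ω => ?_
      have hP1 : 1 ≤ Real.logb 2 P := by
        rw [Real.le_logb_iff_rpow_le (by norm_num) (by linarith)]
        simpa using hP
      have hlow : 0 ≤ Real.logb 2 (1 + S P ω) :=
        Real.logb_nonneg (by norm_num) (by linarith [hS0 P ω])
      have hup : Real.logb 2 (1 + S P ω) ≤ Real.logb 2 P + X ω / Real.log 2 :=
        (Real.logb_le_logb_of_le (by norm_num) (by linarith [hS0 P ω])
          (by linarith [hSle P (by linarith) ω])).trans
          (logb_one_add_mul_le (by linarith) (hX ω))
      have hXl : 0 ≤ X ω / Real.log 2 := div_nonneg (hX ω) hlog2.le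
      rw [Real.norm_of_nonneg (div_nonneg hlow (by linarith)), div_le_iff₀ (by linarith)]
      nlinarith
    · filter_upwards [hSge] with ω ⟨c, hc, hcS⟩
      refine tendsto_logb_one_add_div_logb hc (hX ω) hcS ?_
      filter_upwards [eventually_ge_atTop 1] with P hP using hSle P hP ω
  simpa using hlim
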